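/- Let $\ell\ge 1$ and $i\in\{0,1,\dots,\ell\}$ be integers. Take $\ell$ copies of the positive integers, the copies being indexed by $h=0,\dots,\ell-1$. A CMPP partition is an assignment of a frequency $f_m^{(h)}\in\mathbb{Z}_{\ge 0}$ to each copy $m^{(h)}$ of each positive integer $m$, with only finitely many nonzero frequencies. Its weight is $\sum_{m,h} m f_m^{(h)}$ and its number of parts is $\sum_{m,h} f_m^{(h)}$. Given initial conditions $k_0,\dots,k_\ell\in\mathbb{Z}_{\ge 0}$ with $k=k_0+\cdots+k_\ell>0$, arrange the frequencies and the initial conditions in a diagram with rows $0,1,\dots,2\ell-1$, counted from the bottom: for $0\le h\le \ell-1$, row $2h$ has in column $0$ the entry $k_0$ if $h=0$ and $0$ if $h>0$, and in each column $m=2,4,6,\dots$ the entry $f_m^{(h)}$; row $2h+1$ has in column $-1$ the entry $k_{h+1}$, and in each column $m=1,3,5,\dots$ the entry $f_m^{(h)}$. A downward path starts at any position of the top row, and each of its steps goes from a position in row $r$ and column $c$ to a position of the diagram in row $r-1$ and column $c-1$ or $c+1$, until it reaches the bottom row. The CMPP partition is $[k_0,\dots,k_\ell]$-admissible if the sum of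 the entries along each downward path is at most $k$. Now let $k_i=1$ and $k_j=0$ for all $j\ne i$ (so $k=1$), let $F(i,j,n)$ be the number of $[k_0,\dots,k_\ell]$-admissible CMPP partitions of weight $n$ with $j$ parts, and let $$P_i(z;q)=\sum_{j,n\ge 0}F(i,j,n)\,q^n z^j .$$ Then, as formal power series in $q$ and $z$, $$P_i(z;q)=\sum_{n_1,\dots,n_\ell\ge 0}\frac{q^{N_1^2+N_2^2+\cdots+N_\ell^2+L_{\ell,i}(N_1,\dots,N_\ell)}\,z^{N_1}}{(q;q)_{n_1}(q;q)_{n_2}\cdots(q;q)_{n_\ell}},$$ where $(q;q)_n=\prod_{j=1}^n(1-q^j)$, $N_s=n_s+n_{s+1}+\cdots+n_\ell$ for $1\le s\le\ell$, and $$L_{\ell,i}(N_1,\dots,N_\ell)=\sum_{s=a}^{\ell}N_s,\qquad a=\begin{cases}2i+1 & \text{if } 2i\le\ell,\\ 2(\ell-i)+2 & \text{if } 2i>\ell,\end{cases}$$ an empty sum being $0$. Thus $L_{\ell,0}=N_1+\cdots+N_\ell$, $L_{\ell,\ell}=N_2+\cdots+N_\ell$, $L_{\ell,1}=N_3+\cdots+N_\ell$,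 $L_{\ell,\ell-1}=N_4+\cdots+N_\ell$, and so on along the sequence $0,\ell,1,\ell-1,2,\ell-2,\dots$ of all the indices $0,\dots,\ell$. -/

import Mathlib

open scoped MvPowerSeries.WithPiTopology

namespace CMPP

/-- The parts: `ℓ` copies of the positive integers. `(m, h)` is the copy of the integer `m` which
has exactly `h` copies of `m` below it in the diagram. -/
abbrev Part (ℓ : ℕ) : Type := ℕ+ × Fin ℓ

/-- A CMPP partition is a finitely supported array of frequencies. -/
abbrev Freq (ℓ : ℕ) : Type := Part ℓ →₀ ℕ

/-- The number partitioned. -/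
def weight {ℓ : ℕ} (f : Freq ℓ) : ℕ := f.sum fun p m => m * (p.1 : ℕ)

/-- The number of parts, counted with multiplicity. -/
def length {ℓ : ℕ} (f : Freq ℓ) : ℕ := f.sum fun _ m => m

/-- The entry of the diagram in row `r` (counted from the bottom, from `0` to `2ℓ - 1`) and
column `c ≥ -1`, where `c` has the parity of `r`.

The even row `2h` reads `k₀` (if `h = 0`) or `0` (if `h > 0`) in column `0`, followed by the
frequencies of the even parts `2, 4, 6, …` of copy `h` in columns `2, 4, 6, …`. The odd row `2h + 1`
reads `k_{h+1}` in column `-1`, followed by the frequencies of the odd parts `1, 3, 5, …` of copy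
`h` in columns `1, 3, 5, …`. -/
def entry {ℓ : ℕ} (k : Fin (ℓ + 1) → ℕ) (f : Freq ℓ) (r : Fin (2 * ℓ)) (c : ℤ) : ℕ :=
  if hc : 0 < c then f (⟨c.toNat, by omega⟩, ⟨(r : ℕ) / 2, by omega⟩)
  else if c = 0 then (if (r : ℕ) = 0 then k 0 else 0)
  else if c = -1 then k ⟨((r : ℕ) + 1) / 2, by omega⟩
  else 0

/-- A downward path runs through all the rows, from the top row to the bottom row, and goes in each
step to one of the (at most two) diagonal neighbours in the next lower row. It is given by its
column `p r` in each row `r`. -/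
def IsDownwardPath {ℓ : ℕ} (p : Fin (2 * ℓ) → ℤ) : Prop :=
  (∀ r, -1 ≤ p r ∧ Even (p r - (r : ℕ))) ∧
    ∀ r s : Fin (2 * ℓ), (s : ℕ) + 1 = r → p s = p r - 1 ∨ p s = p r + 1

/-- `[k₀, …, k_ℓ]`-admissibility: every downward sum is at most `k₀ + ⋯ + k_ℓ`. -/
def IsAdmissible {ℓ : ℕ} (k : Fin (ℓ + 1) → ℕ) (f : Freq ℓ) : Prop :=
  ∀ p : Fin (2 * ℓ) → ℤ, IsDownwardPath p → ∑ r, entry k f r (p r) ≤ ∑ j, k j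

/-- The `[k₀, …, k_ℓ]`-admissible CMPP partitions of `n` with `j` parts. -/
def admissible {ℓ : ℕ} (k : Fin (ℓ + 1) → ℕ) (j n : ℕ) : Set (Freq ℓ) :=
  {f | IsAdmissible k f ∧ length f = j ∧ weight f = n}

/-- There are finitely many of them, so that `Set.ncard` is their actual number. -/
theorem finite_admissible {ℓ : ℕ} (k : Fin (ℓ + 1) → ℕ) (j n : ℕ) :
    (admissible k j n).Finite := by
  classical
  let S : Finset (Part ℓ) := Finset.Icc 1 (Nat.succPNat n) ×ˢ Finset.univ
  refine (Set.finite_Iic (Finsupp.indicator S fun _ _ => n)).subset ?_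
  rintro f ⟨-, -, hw⟩ p
  have key : f p * (p.1 : ℕ) ≤ n := by
    by_cases hp : p ∈ f.support
    · rw [← hw]
      exact Finset.single_le_sum (f := fun p : Part ℓ => f p * (p.1 : ℕ))
        (fun _ _ => Nat.zero_le _) hp
    · simp [Finsupp.notMem_support_iff.1 hp]
  have hpos : 1 ≤ (p.1 : ℕ) := p.1.pos
  rw [Finsupp.indicator_apply]
  split_ifs with hp
  · nlinarith
  · by_contra hne
    apply hp
    have hle : (p.1 : ℕ) ≤ n + 1 := by
      have : 1 ≤ f p := by omega
      nlinarith
    simp only [S, Finset.mem_product, Finset.mem_Icc, Finset.mem_univ, and_true]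
    exact ⟨one_le, hle⟩

/-- The bivariate generating function `∑_{j, n ≥ 0} F(j, n) q^n z^j`, a formal power series in
`q = X 0` and `z = X 1`, where `F(j, n)` is the number of admissible CMPP partitions of `n` with
`j` parts. -/
noncomputable def genFun {ℓ : ℕ} (k : Fin (ℓ + 1) → ℕ) : MvPowerSeries (Fin 2) ℤ :=
  fun d => ((admissible k (d 1) (d 0)).ncard : ℤ)

/-- The variable `q`, which marks the weight. -/
noncomputable def q : MvPowerSeries (Fin 2) ℤ := MvPowerSeries.X 0

/-- The variable `z`, which marks the number of parts. -/
noncomputable def z : MvPowerSeries (Fin 2) ℤ := MvPowerSeries.X 1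

/-- The `q`-Pochhammer symbol `(a; b)_n = ∏_{j=1}^{n} (1 - a b^{j-1})`. -/
def qPochhammer {R : Type*} [CommRing R] (a b : R) (n : ℕ) : R :=
  ∏ j ∈ Finset.range n, (1 - a * b ^ j)

/-- The power series `1 / (q; q)_n`. -/
noncomputable def invPoch (n : ℕ) : MvPowerSeries (Fin 2) ℤ :=
  MvPowerSeries.invOfUnit (qPochhammer q q n) 1

theorem qPochhammer_mul_invPoch (n : ℕ) : qPochhammer q q n * invPoch n = 1 := by
  refine MvPowerSeries.mul_invOfUnit _ _ ?_
  simp [qPochhammer, q, map_prod]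

/-- The tail sum `N_s = n_s + n_{s+1} + ⋯ + n_ℓ` for `1 ≤ s ≤ ℓ`; here `n_t` is `n (t - 1)`, since
`Fin ℓ` counts from `0`. -/
def tailSum {ℓ : ℕ} (n : Fin ℓ → ℕ) (s : ℕ) : ℕ :=
  ∑ t ∈ Finset.univ.filter (fun t : Fin ℓ => s ≤ (t : ℕ) + 1), n t

/-- The index at which the linear form with index `i` starts. Along the sequence
`0, ℓ, 1, ℓ - 1, 2, ℓ - 2, …`, which runs once through `0, …, ℓ`, it takes the values
`1, 2, 3, 4, 5, 6, …, ℓ + 1`. -/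
def linStart (ℓ i : ℕ) : ℕ := if 2 * i ≤ ℓ then 2 * i + 1 else 2 * (ℓ - i) + 2

/-- The linear form `L_{ℓ,i} = N_a + N_{a+1} + ⋯ + N_ℓ`, where `a = linStart ℓ i`. -/
def linForm {ℓ : ℕ} (i : Fin (ℓ + 1)) (n : Fin ℓ → ℕ) : ℕ :=
  ∑ s ∈ Finset.Icc (linStart ℓ i) ℓ, tailSum n s

/-- The summand
`q^{N_1² + ⋯ + N_ℓ² + L_{ℓ,i}(N_1, …, N_ℓ)} z^{N_1} / ((q; q)_{n_1} ⋯ (q; q)_{n_ℓ})`. -/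
noncomputable def term {ℓ : ℕ} (i : Fin (ℓ + 1)) (n : Fin ℓ → ℕ) : MvPowerSeries (Fin 2) ℤ :=
  q ^ ((∑ s ∈ Finset.Icc 1 ℓ, tailSum n s ^ 2) + linForm i n) * z ^ tailSum n 1 *
    ∏ s, invPoch (n s)

end CMPP

/-!
For `k = 1` an admissible array has frequencies `0` and `1`, and two occupied positions in rows
`r, r'` and columns `c < c'` of the diagram lie on a common downward path exactly if
`c' - c ≤ |r' - r|`. By the triangle inequality only consecutive positions have to be compared, so
that the admissible partitions are the chains of positions, starting from the one nonzero initial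
condition, in which every step goes from `(r, c)` to some `(r', c')` with
`c' = c + |r' - r| + 2 + 2k` and `k ≥ 0` (the parities of row and column agree). Consequently the
generating function of the chains with `N` parts that start in row `r` and column `c = e - 1` is
`q ^ (N (N + e))` times a series `S_N(r)` with `S_0 = 1` and
`(1 - x²) S_{N+1}(r) = ∑_{r' < 2ℓ} x^|r - r'| S_N(r')`, where `x = q ^ (N + 1)`
(`ncard_chainSet`).

The kernel `x^|r - r'|` is inverted by a second difference: the relation follows from
`(1 + x²) S_{N+1}(r) = x (S_{N+1}(r - 1) + S_{N+1}(r + 1)) + S_N(r)` in the inner rows, with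
`S_{N+1}(0) = x S_{N+1}(1) + S_N(0)` and its mirror image at the two ends (`sum_pow_dist_mul`).
These local relations are solved by the multisum: summing over `n_1, …, n_ℓ` with `N_1 = N` is
iterating the Bailey-type transform `f ↦ ∑_M q ^ (M²) f_M / (q; q)_{N - M}`, and the local relations
are carried along by this transform (`baileyTransform_recurrence`) with `r` moving up by one. The
multisum for `ℓ` becomes constant in `r` at `r = ℓ - 1`, which lets it be continued to the upper
half of the rows by the reflection `r ↦ 2ℓ - 1 - r` (`baileySum_kernel`). The reflection is also
what produces the order `0, ℓ, 1, ℓ - 1, …` of the linear forms.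
-/

namespace CMPP

/-! ### Iterated Bailey-type sums -/

section Algebra

variable {R : Type*} [CommRing R] (x : R) (p : ℕ → R)

/-- The transform `f ↦ ∑_{M ≤ N} x ^ (M²) p_{N - M} f_M`. In the application `x = q` and
`p_n = 1 / (q; q)_n`. -/
def baileyTransform (f : ℕ → R) (N : ℕ) : R :=
  ∑ M ∈ Finset.range (N + 1), x ^ M ^ 2 * p (N - M) * f M

/-- The sum over `N ≥ N_2 ≥ ⋯ ≥ N_{ℓ+1} = 0` of
`x ^ (N_2² + ⋯ + N_ℓ² + N_{r+2} + ⋯ + N_ℓ) p_{N - N_2} p_{N_2 - N_3} ⋯ p_{N_ℓ}`, where `r` is a row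
and `N` is the last argument, built up one summation at a time. For `ℓ = 0` the sum is the indicator
of `N = 0`. -/
def baileySum : ℕ → ℕ → ℕ → R
  | 0, _, N => if N = 0 then 1 else 0
  | ℓ + 1, 0, N => baileyTransform x p (fun M => x ^ M * baileySum ℓ 0 M) N
  | ℓ + 1, r + 1, N => baileyTransform x p (fun M => baileySum ℓ r M) N

/-- The transform preserves the three-term recurrence. The factor `1 + x^{2N}` splits off
`(1 - x^{N-M}) (1 - x^{N+M})`, whose first factor lowers `p_{N-M}` to `p_{N-1-M}`; what is left over
cancels against the inhomogeneous term `f (M - 1)` after a shift of `M`. -/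
theorem baileyTransform_recurrence {x : R} {p : ℕ → R}
    (hp : ∀ N, p N = (1 - x ^ (N + 1)) * p (N + 1)) {f g h : ℕ → R}
    (h0 : 2 * f 0 = g 0 + h 0)
    (hf : ∀ M, (1 + x ^ (2 * (M + 1))) * f (M + 1)
      = x ^ (M + 1) * (g (M + 1) + h (M + 1)) + f M) (N : ℕ) :
    (1 + x ^ (2 * (N + 1))) * baileyTransform x p f (N + 1)
      = x ^ (N + 1) * (baileyTransform x p g (N + 1) + baileyTransform x p h (N + 1))
        + baileyTransform x p f N := by
  -- The recurrence for `f` replaces `x ^ M * (g M + h M)` by `(1 + x ^ (2 * M)) * f M - f (M - 1)`,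
  -- where `f (-1)` is read as `0`.
  have key : ∀ M ∈ Finset.range (N + 2),
      (1 + x ^ (2 * (N + 1))) * (x ^ M ^ 2 * p (N + 1 - M) * f M)
        - x ^ (N + 1) * (x ^ M ^ 2 * p (N + 1 - M) * g M + x ^ M ^ 2 * p (N + 1 - M) * h M)
      = x ^ M ^ 2 * p (N + 1 - M) * ((1 - x ^ (N + 1 - M)) * (1 - x ^ (N + 1 + M)) * f M)
        + x ^ M ^ 2 * p (N + 1 - M) * x ^ (N + 1 - M) *
          (if M = 0 then 0 else f (M - 1)) := by
    intro M hM
    have hM' : M ≤ N + 1 := by simpa [Nat.lt_succ_iff] using hM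
    obtain ⟨d, hd⟩ := Nat.exists_eq_add_of_le hM'
    have e1 : N + 1 - M = d := by omega
    rw [e1, hd]
    rcases M with _ | M
    · simp only [if_true]
      linear_combination (x ^ d * p d) * h0
    · simp only [Nat.succ_ne_zero, if_false, Nat.add_sub_cancel]
      linear_combination (x ^ (M + 1) ^ 2 * p d * x ^ d) * hf M
  have hsum := Finset.sum_congr rfl key
  rw [Finset.sum_sub_distrib, ← Finset.mul_sum, ← Finset.mul_sum, Finset.sum_add_distrib,
    Finset.sum_add_distrib, Finset.sum_range_succ (fun M => x ^ M ^ 2 * p (N + 1 - M) *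
      ((1 - x ^ (N + 1 - M)) * (1 - x ^ (N + 1 + M)) * f M)),
    Finset.sum_range_succ' (fun M => x ^ M ^ 2 * p (N + 1 - M) * x ^ (N + 1 - M) *
          (if M = 0 then 0 else f (M - 1)))] at hsum
  have h2 : ∑ M ∈ Finset.range (N + 1), x ^ M ^ 2 * p (N + 1 - M) *
      ((1 - x ^ (N + 1 - M)) * (1 - x ^ (N + 1 + M)) * f M)
      + ∑ M ∈ Finset.range (N + 1), x ^ (M + 1) ^ 2 * p (N + 1 - (M + 1)) *
        x ^ (N + 1 - (M + 1)) * (if M + 1 = 0 then 0 else f (M + 1 - 1))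
      = ∑ M ∈ Finset.range (N + 1), x ^ M ^ 2 * p (N - M) * f M := by
    rw [← Finset.sum_add_distrib]
    refine Finset.sum_congr rfl fun M hM => ?_
    have hM' : M ≤ N := by simpa [Nat.lt_succ_iff] using hM
    obtain ⟨d, rfl⟩ := Nat.exists_eq_add_of_le hM'
    rw [show M + d + 1 - M = d + 1 by omega, show M + d + 1 - (M + 1) = d by omega,
      show M + d - M = d by omega, hp d]
    simp only [Nat.succ_ne_zero, if_false, Nat.add_sub_cancel]
    ring
  simp only [Nat.sub_self, pow_zero, sub_self, zero_mul, mul_zero, add_zero, if_true] at hsum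
  rw [h2] at hsum
  simp only [baileyTransform]
  linear_combination hsum

variable {x : R} {p : ℕ → R}

theorem baileySum_zero_right (hp0 : p 0 = 1) (ℓ r : ℕ) : baileySum x p ℓ r 0 = 1 := by
  induction ℓ generalizing r with
  | zero => simp [baileySum]
  | succ ℓ ih => cases r <;> simp [baileySum, baileyTransform, hp0, ih]

/-- From `r = ℓ - 1` on the linear part of the exponent is empty, so the sum no longer depends
on `r`. -/
theorem baileySum_succ_of_le {ℓ r : ℕ} (h : ℓ ≤ r + 1) :
    baileySum x p ℓ (r + 1) = baileySum x p ℓ r := by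
  induction ℓ generalizing r with
  | zero => funext N; simp [baileySum]
  | succ ℓ ih =>
    funext N
    cases r with
    | zero =>
      obtain rfl : ℓ = 0 := by omega
      simp only [baileySum]
      congr 1
      funext M
      split_ifs with hM <;> simp [hM]
    | succ r =>
      simp only [baileySum]
      rw [ih (by omega)]

theorem baileySum_recurrence_zero (hp : ∀ N, p N = (1 - x ^ (N + 1)) * p (N + 1)) (ℓ N : ℕ) :
    baileySum x p (ℓ + 1) 0 (N + 1)
      = x ^ (N + 1) * baileySum x p (ℓ + 1) 1 (N + 1) + baileySum x p (ℓ + 1) 0 N := by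
  simp only [baileySum, baileyTransform]
  rw [← sub_eq_iff_eq_add', Finset.mul_sum, ← Finset.sum_sub_distrib, Finset.sum_range_succ]
  refine (congrArg₂ (· + ·) (Finset.sum_congr rfl fun M hM => ?_) ?_).trans (add_zero _)
  · have hM' : M ≤ N := by simpa [Nat.lt_succ_iff] using hM
    obtain ⟨d, rfl⟩ := Nat.exists_eq_add_of_le hM'
    rw [show M + d + 1 - M = d + 1 by omega, show M + d - M = d by omega, hp d]
    ring
  · ring

/-- The local relation in the lower half of the rows. The induction uses `x ^ M` times the sum in
row `0` as the value in row `-1`, for which the relation at the bottom row takes the same shape. -/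
theorem baileySum_recurrence (hp0 : p 0 = 1) (hp : ∀ N, p N = (1 - x ^ (N + 1)) * p (N + 1))
    {ℓ r : ℕ} (h : r + 1 < ℓ) (N : ℕ) :
    (1 + x ^ (2 * (N + 1))) * baileySum x p ℓ (r + 1) (N + 1)
      = x ^ (N + 1) * (baileySum x p ℓ r (N + 1) + baileySum x p ℓ (r + 2) (N + 1))
        + baileySum x p ℓ (r + 1) N := by
  induction ℓ generalizing r N with
  | zero => omega
  | succ ℓ ih =>
    cases r with
    | zero =>
      simp only [baileySum]
      refine baileyTransform_recurrence hp ?_ (fun M => ?_) N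
      · simp only [baileySum_zero_right hp0]; norm_num
      · obtain ⟨ℓ, rfl⟩ : ∃ m, ℓ = m + 1 := ⟨ℓ - 1, by omega⟩
        linear_combination baileySum_recurrence_zero hp ℓ M
    | succ r =>
      simp only [baileySum]
      refine baileyTransform_recurrence hp ?_ (fun M => ?_) N
      · simp only [baileySum_zero_right hp0]; norm_num
      · exact ih (by omega) M

/-- The matrix `y^|r - s|` of size `m` is inverted, up to the factor `1 - y²`, by a tridiagonal
matrix. The exponent `(r - s) + (s - r)`, with truncated subtraction, is `|r - s|`. -/
theorem sum_pow_dist_mul {m : ℕ} (y : R) (u g : ℕ → R) (hm : 2 ≤ m)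
    (hleft : g 0 = u 0 - y * u 1)
    (hmid : ∀ r, r + 2 < m → g (r + 1) = (1 + y ^ 2) * u (r + 1) - y * (u r + u (r + 2)))
    (hright : ∀ r, r + 2 = m → g (r + 1) = u (r + 1) - y * u r) {r : ℕ} (hr : r < m) :
    ∑ s ∈ Finset.range m, y ^ ((r - s) + (s - r)) * g s = (1 - y ^ 2) * u r := by
  -- The parts of the sum to the left and to the right of the diagonal telescope separately.
  have hL : ∀ r, r + 1 < m →
      ∑ s ∈ Finset.range (r + 1), y ^ (r + 1 - s) * g s = y * u r - y ^ 2 * u (r + 1) := by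
    intro r
    induction r with
    | zero => intro _; simp [hleft]; ring
    | succ r ih =>
      intro h
      have e : ∑ s ∈ Finset.range (r + 1), y ^ (r + 1 + 1 - s) * g s
          = y * ∑ s ∈ Finset.range (r + 1), y ^ (r + 1 - s) * g s := by
        rw [Finset.mul_sum]
        refine Finset.sum_congr rfl fun s hs => ?_
        have : s < r + 1 := by simpa using hs
        rw [show r + 1 + 1 - s = r + 1 - s + 1 by omega]
        ring
      rw [Finset.sum_range_succ, e, ih (by omega), hmid r (by omega),
        show r + 1 + 1 - (r + 1) = 1 by omega]
      ring
  have hR : ∀ k r, r + 2 + k = m →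
      ∑ j ∈ Finset.range (k + 1), y ^ (j + 1) * g (r + 1 + j) = y * u (r + 1) - y ^ 2 * u r := by
    intro k
    induction k with
    | zero => intro r h; simp [hright r (by omega)]; ring
    | succ k ih =>
      intro r h
      have e : ∑ j ∈ Finset.range (k + 1), y ^ (j + 1 + 1) * g (r + 1 + (j + 1))
          = y * ∑ j ∈ Finset.range (k + 1), y ^ (j + 1) * g (r + 1 + 1 + j) := by
        rw [Finset.mul_sum]
        refine Finset.sum_congr rfl fun j _ => ?_
        rw [show r + 1 + (j + 1) = r + 1 + 1 + j by omega]
        ring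
      rw [Finset.sum_range_succ', e, ih (r + 1) (by omega), add_zero, hmid r (by omega)]
      ring
  have hsplit : ∑ s ∈ Finset.range m, y ^ ((r - s) + (s - r)) * g s
      = ∑ s ∈ Finset.range r, y ^ (r - s) * g s + g r
        + ∑ j ∈ Finset.range (m - (r + 1)), y ^ (j + 1) * g (r + 1 + j) := by
    conv_lhs => rw [show m = r + 1 + (m - (r + 1)) by omega]
    rw [Finset.sum_range_add, Finset.sum_range_succ]
    congr 1
    · congr 1
      · refine Finset.sum_congr rfl fun s hs => ?_
        have : s < r := by simpa using hs
        rw [show s - r = 0 by omega, add_zero]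
      · simp
    · refine Finset.sum_congr rfl fun j _ => ?_
      rw [show r - (r + 1 + j) + (r + 1 + j - r) = j + 1 by omega]
  rw [hsplit]
  rcases r with _ | r
  · rw [show m - (0 + 1) = m - 2 + 1 by omega, hR (m - 2) 0 (by omega), hleft]
    simp; ring
  · rw [hL r hr]
    by_cases h : r + 2 = m
    · rw [show m - (r + 1 + 1) = 0 by omega, hright r h]
      simp; ring
    · rw [show m - (r + 1 + 1) = m - (r + 3) + 1 by omega, hR (m - (r + 3)) (r + 1) (by omega),
        hmid r (by omega)]
      ring

/-- The sums, continued to all `2ℓ` rows by the reflection `r ↦ 2ℓ - 1 - r`, satisfy the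
transfer relation of the chain generating functions. -/
theorem baileySum_kernel (hp0 : p 0 = 1) (hp : ∀ N, p N = (1 - x ^ (N + 1)) * p (N + 1))
    {ℓ r : ℕ} (hr : r < 2 * ℓ) (N : ℕ) :
    ∑ s ∈ Finset.range (2 * ℓ), x ^ ((N + 1) * ((r - s) + (s - r))) *
        baileySum x p ℓ (min s (2 * ℓ - 1 - s)) N
      = (1 - x ^ (2 * (N + 1))) * baileySum x p ℓ (min r (2 * ℓ - 1 - r)) (N + 1) := by
  obtain ⟨ℓ, rfl⟩ : ∃ m, ℓ = m + 1 := ⟨ℓ - 1, by omega⟩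
  have hbot := baileySum_recurrence_zero hp ℓ N
  have hmid := fun {r : ℕ} (h : r + 1 < ℓ + 1) => baileySum_recurrence hp0 hp h N
  -- The two middle rows `ℓ` and `ℓ + 1` carry equal values, so that the sum in row `ℓ + 1` may be
  -- read either as a reflected value or as the next unreflected one.
  have htop : baileySum x p (ℓ + 1) (ℓ + 1) = baileySum x p (ℓ + 1) ℓ :=
    baileySum_succ_of_le le_rfl
  have fold : ∀ s ≤ ℓ + 1,
      baileySum x p (ℓ + 1) (min s (2 * (ℓ + 1) - 1 - s)) = baileySum x p (ℓ + 1) s := by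
    intro s hs
    rcases hs.lt_or_eq with h | rfl
    · congr 1; omega
    · rw [htop]; congr 1; omega
  have fold' : ∀ s t, s + t = 2 * ℓ + 1 → s ≤ ℓ + 1 →
      baileySum x p (ℓ + 1) (min t (2 * (ℓ + 1) - 1 - t)) = baileySum x p (ℓ + 1) s := by
    intro s t hst hs
    rw [← fold s hs]
    congr 1; omega
  simp only [pow_mul]
  rw [pow_right_comm, sum_pow_dist_mul (x ^ (N + 1))
    (fun r => baileySum x p (ℓ + 1) (min r (2 * (ℓ + 1) - 1 - r)) (N + 1)) _ (by omega) ?_ ?_ ?_ hr]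
  · rw [fold 0 (by omega), fold 1 (by omega)]
    linear_combination -hbot
  · intro r hr
    rcases lt_or_ge r ℓ with h | h
    · rw [fold r (by omega), fold (r + 1) (by omega), fold (r + 2) (by omega)]
      linear_combination -hmid (show r + 1 < ℓ + 1 by omega)
    · obtain ⟨t, ht⟩ : ∃ t, t + (r + 2) = 2 * ℓ + 1 := ⟨2 * ℓ + 1 - (r + 2), by omega⟩
      rw [fold' (t + 2) r (by omega) (by omega), fold' (t + 1) (r + 1) (by omega) (by omega),
        fold' t (r + 2) ht (by omega)]
      linear_combination -hmid (show t + 1 < ℓ + 1 by omega)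
  · intro r hr
    rw [fold' 0 (r + 1) (by omega) (by omega), fold' 1 r (by omega) (by omega)]
    linear_combination -hbot

end Algebra

/-! ### The multisum as an iterated transform -/

theorem tailSum_one {ℓ : ℕ} (n : Fin ℓ → ℕ) : tailSum n 1 = ∑ t, n t := by
  simp [tailSum]

theorem tailSum_cons_succ_succ {ℓ : ℕ} (a : ℕ) (n : Fin ℓ → ℕ) (s : ℕ) :
    tailSum (Fin.cons a n : Fin (ℓ + 1) → ℕ) (s + 2) = tailSum n (s + 1) := by
  simp [tailSum, Finset.sum_filter, Fin.sum_univ_succ]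

theorem sum_piAntidiag_fin_succ {A : Type*} [AddCommMonoid A] {ℓ : ℕ} (N : ℕ)
    (F : (Fin (ℓ + 1) → ℕ) → A) :
    ∑ n ∈ Finset.piAntidiag Finset.univ N, F n
      = ∑ M ∈ Finset.range (N + 1), ∑ n ∈ Finset.piAntidiag Finset.univ M,
          F (Fin.cons (N - M) n) := by
  rw [Finset.sum_sigma']
  refine Finset.sum_nbij' (fun n => ⟨∑ t, Fin.tail n t, Fin.tail n⟩)
    (fun s => Fin.cons (N - s.1) s.2) ?_ ?_ ?_ ?_ ?_
  · intro n hn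
    simp only [Finset.mem_piAntidiag, Fin.sum_univ_succ] at hn
    simp only [Finset.mem_sigma, Finset.mem_range, Finset.mem_piAntidiag, Fin.tail]
    exact ⟨by omega, by simp; rfl⟩
  · rintro ⟨M, n⟩ hn
    simp only [Finset.mem_sigma, Finset.mem_range, Finset.mem_piAntidiag] at hn
    simp only [Finset.mem_piAntidiag, Fin.sum_univ_succ, Fin.cons_zero, Fin.cons_succ, hn.2.1]
    exact ⟨by omega, by simp⟩
  · intro n hn
    simp only [Finset.mem_piAntidiag, Fin.sum_univ_succ] at hn
    have : N - ∑ t, Fin.tail n t = n 0 := by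
      simp only [Fin.tail]; omega
    simp only [this, Fin.cons_self_tail]
  · rintro ⟨M, n⟩ hn
    simp only [Finset.mem_sigma, Finset.mem_range, Finset.mem_piAntidiag] at hn
    simp [hn.2.1]
  · intro n hn
    simp only [Finset.mem_piAntidiag, Fin.sum_univ_succ] at hn
    have : N - ∑ t, Fin.tail n t = n 0 := by
      simp only [Fin.tail]; omega
    simp only [this, Fin.cons_self_tail]

/-- The exponent `N_1² + ⋯ + N_ℓ² + N_a + ⋯ + N_ℓ`. -/
def tailExponent {ℓ : ℕ} (a : ℕ) (n : Fin ℓ → ℕ) : ℕ :=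
  (∑ s ∈ Finset.Icc 1 ℓ, tailSum n s ^ 2) + ∑ s ∈ Finset.Icc a ℓ, tailSum n s

theorem sum_Icc_tailSum_cons {ℓ : ℕ} (c a : ℕ) (n : Fin ℓ → ℕ) (g : ℕ → ℕ) :
    ∑ s ∈ Finset.Icc (a + 2) (ℓ + 1), g (tailSum (Fin.cons c n : Fin (ℓ + 1) → ℕ) s)
      = ∑ s ∈ Finset.Icc (a + 1) ℓ, g (tailSum n s) := by
  rw [← Finset.Ico_add_one_right_eq_Icc, ← Finset.Ico_add_one_right_eq_Icc,
    ← Finset.sum_Ico_add' _ (a + 1) (ℓ + 1) 1]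
  refine Finset.sum_congr rfl fun s hs => ?_
  obtain ⟨t, rfl⟩ : ∃ t, s = t + 1 := ⟨s - 1, by have := (Finset.mem_Ico.1 hs).1; omega⟩
  rw [tailSum_cons_succ_succ]

theorem sum_Icc_one_tailSum_cons {ℓ N M : ℕ} (hM : M ≤ N) {n : Fin ℓ → ℕ} (hn : ∑ t, n t = M)
    (g : ℕ → ℕ) :
    ∑ s ∈ Finset.Icc 1 (ℓ + 1), g (tailSum (Fin.cons (N - M) n : Fin (ℓ + 1) → ℕ) s)
      = g N + ∑ s ∈ Finset.Icc 1 ℓ, g (tailSum n s) := by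
  have h1 : tailSum (Fin.cons (N - M) n : Fin (ℓ + 1) → ℕ) 1 = N := by
    rw [tailSum_one, Fin.sum_univ_succ]
    simp only [Fin.cons_zero, Fin.cons_succ, hn]
    omega
  rw [← sum_Icc_tailSum_cons (N - M) 0 n g, ← Finset.Ico_add_one_right_eq_Icc,
    Finset.sum_eq_sum_Ico_succ_bot (by omega), h1, Finset.Ico_add_one_right_eq_Icc]

theorem tailExponent_cons_add_two {ℓ N M : ℕ} (hM : M ≤ N) (a : ℕ) {n : Fin ℓ → ℕ}
    (hn : ∑ t, n t = M) :
    tailExponent (a + 2) (Fin.cons (N - M) n : Fin (ℓ + 1) → ℕ)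
      = N ^ 2 + tailExponent (a + 1) n := by
  rw [tailExponent, tailExponent, sum_Icc_one_tailSum_cons hM hn (· ^ 2),
    sum_Icc_tailSum_cons (N - M) a n (fun m => m), add_assoc]

theorem tailExponent_cons_one {ℓ N M : ℕ} (hM : M ≤ N) {n : Fin ℓ → ℕ}
    (hn : ∑ t, n t = M) :
    tailExponent 1 (Fin.cons (N - M) n : Fin (ℓ + 1) → ℕ)
      = N ^ 2 + N + tailExponent 1 n := by
  rw [tailExponent, tailExponent, sum_Icc_one_tailSum_cons hM hn (· ^ 2),
    sum_Icc_one_tailSum_cons hM hn (fun m => m)]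
  ring

/-- The multisum with `N_1 = N` prescribed is an iterated transform. Splitting off `n_1 = N_1 - N_2`
leaves the multisum for `ℓ - 1` with `N_2` prescribed and the start of the linear form lowered by
one. -/
theorem sum_piAntidiag_tailExponent {R : Type*} [CommRing R] (x : R) (p : ℕ → R) (ℓ N : ℕ) :
    (∑ n ∈ Finset.piAntidiag (Finset.univ : Finset (Fin ℓ)) N,
        x ^ tailExponent 1 n * ∏ s, p (n s) = x ^ (N ^ 2 + N) * baileySum x p ℓ 0 N) ∧
    ∀ r, ∑ n ∈ Finset.piAntidiag (Finset.univ : Finset (Fin ℓ)) N,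
        x ^ tailExponent (r + 2) n * ∏ s, p (n s) = x ^ N ^ 2 * baileySum x p ℓ r N := by
  induction ℓ generalizing N with
  | zero =>
    rcases N with _ | N
    · simp [tailExponent, baileySum]
    · simp [baileySum]
  | succ ℓ ih =>
    refine ⟨?_, fun r => ?_⟩
    · rw [sum_piAntidiag_fin_succ, baileySum, baileyTransform, Finset.mul_sum]
      refine Finset.sum_congr rfl fun M hM => ?_
      have hM' : M ≤ N := by simpa [Nat.lt_succ_iff] using hM
      calc _ = x ^ (N ^ 2 + N) * p (N - M) *
            ∑ n ∈ Finset.piAntidiag (Finset.univ : Finset (Fin ℓ)) M,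
              x ^ tailExponent 1 n * ∏ s, p (n s) := by
            rw [Finset.mul_sum]
            refine Finset.sum_congr rfl fun n hn => ?_
            rw [tailExponent_cons_one hM' (Finset.mem_piAntidiag.1 hn).1, Fin.prod_univ_succ]
            simp only [Fin.cons_zero, Fin.cons_succ]
            ring
        _ = _ := by rw [(ih M).1]; ring
    · have key : ∀ M ∈ Finset.range (N + 1),
          ∑ n ∈ Finset.piAntidiag (Finset.univ : Finset (Fin ℓ)) M,
            x ^ tailExponent (r + 2) (Fin.cons (N - M) n : Fin (ℓ + 1) → ℕ) *
              ∏ s, p ((Fin.cons (N - M) n : Fin (ℓ + 1) → ℕ) s)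
          = x ^ N ^ 2 * p (N - M) * ∑ n ∈ Finset.piAntidiag (Finset.univ : Finset (Fin ℓ)) M,
              x ^ tailExponent (r + 1) n * ∏ s, p (n s) := by
        intro M hM
        have hM' : M ≤ N := by simpa [Nat.lt_succ_iff] using hM
        rw [Finset.mul_sum]
        refine Finset.sum_congr rfl fun n hn => ?_
        rw [tailExponent_cons_add_two hM' r (Finset.mem_piAntidiag.1 hn).1, Fin.prod_univ_succ]
        simp only [Fin.cons_zero, Fin.cons_succ]
        ring
      rw [sum_piAntidiag_fin_succ, Finset.sum_congr rfl key]
      rcases r with _ | r <;> rw [baileySum, baileyTransform, Finset.mul_sum] <;>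
        refine Finset.sum_congr rfl fun M hM => ?_
      · rw [(ih M).1]; ring
      · rw [(ih M).2]; ring

/-! ### Chains of parts -/

section Chains

variable {ℓ : ℕ}

/-- The row of a part in the diagram; its column is the integer itself. -/
def row (a : Part ℓ) : ℕ := 2 * (a.2 : ℕ) + (a.1 : ℕ) % 2

theorem row_lt (a : Part ℓ) : row a < 2 * ℓ := by
  have := a.2.isLt
  unfold row
  omega

theorem part_ext {a b : Part ℓ} (hr : row a = row b) (hc : (a.1 : ℕ) = b.1) : a = b := by
  unfold row at hr
  refine Prod.ext (PNat.coe_injective hc) (Fin.ext ?_)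
  omega

/-- The part `a` may follow, in a chain, a position in row `r` and column `e - 1`: its column
exceeds `e - 1` by more than `|r - row a|`. The shift by one keeps `e` a natural number, since
columns start at `-1`. -/
def Beyond (r e : ℕ) (a : Part ℓ) : Prop := e + ((r - row a) + (row a - r)) ≤ (a.1 : ℕ)

theorem Beyond.trans {r e : ℕ} {a b : Part ℓ} (h : Beyond r e a)
    (h' : Beyond (row a) ((a.1 : ℕ) + 1) b) : Beyond r e b := by
  unfold Beyond at *
  omega

/-- The arrays with frequencies `0` and `1` whose parts form a chain of `N` parts and weight `n`
that starts in row `r` and column `e - 1`. Being a chain is expressed by pairwise comparability. -/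
def chainSet (ℓ N r e n : ℕ) : Set (Freq ℓ) :=
  {f | (∀ a, f a ≤ 1) ∧ (∀ a ∈ f.support, Beyond r e a) ∧
    (∀ a ∈ f.support, ∀ b ∈ f.support, a ≠ b →
      Beyond (row a) ((a.1 : ℕ) + 1) b ∨ Beyond (row b) ((b.1 : ℕ) + 1) a) ∧
    length f = N ∧ weight f = n}

theorem length_add (f g : Freq ℓ) : length (f + g) = length f + length g :=
  Finsupp.sum_add_index' (fun _ => rfl) (fun _ _ _ => rfl)

theorem weight_add (f g : Freq ℓ) : weight (f + g) = weight f + weight g :=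
  Finsupp.sum_add_index' (fun _ => zero_mul _) (fun _ _ _ => add_mul _ _ _)

theorem length_single (a : Part ℓ) : length (Finsupp.single a 1) = 1 :=
  Finsupp.sum_single_index rfl

theorem weight_single (a : Part ℓ) : weight (Finsupp.single a 1) = a.1 := by
  rw [weight, Finsupp.sum_single_index (zero_mul _), one_mul]

theorem length_eq_zero_iff (f : Freq ℓ) : length f = 0 ↔ f = 0 := by
  constructor
  · intro h
    ext a
    by_contra ha
    exact ha ((Finset.sum_eq_zero_iff.1 h) a (Finsupp.mem_support_iff.2 ha))
  · rintro rfl; rfl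

theorem chainSet_zero (r e n : ℕ) :
    chainSet ℓ 0 r e n = if n = 0 then {0} else ∅ := by
  ext f
  simp only [chainSet, Set.mem_ofPred_eq, length_eq_zero_iff]
  constructor
  · rintro ⟨-, -, -, rfl, h⟩
    rw [if_pos (by rw [← h]; rfl)]
    rfl
  · split_ifs with h
    · rintro rfl
      refine ⟨by simp, by simp, by simp, rfl, ?_⟩
      rw [h]; rfl
    · exact False.elim

theorem single_add_mem_chainSet {N r e n : ℕ} {a : Part ℓ} {g : Freq ℓ} (ha : Beyond r e a)
    (hg : g ∈ chainSet ℓ N (row a) ((a.1 : ℕ) + 1) n) :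
    Finsupp.single a 1 + g ∈ chainSet ℓ (N + 1) r e (a.1 + n) := by
  obtain ⟨h1, h2, h3, h4, h5⟩ := hg
  have hga : g a = 0 := by
    by_contra h
    have := h2 a (Finsupp.mem_support_iff.2 h)
    unfold Beyond at this
    omega
  have hsupp : ∀ b ∈ (Finsupp.single a 1 + g).support, b = a ∨ b ∈ g.support := by
    intro b hb
    by_contra! h
    rw [Finsupp.mem_support_iff, Finsupp.add_apply, Finsupp.single_apply, if_neg (Ne.symm h.1),
      zero_add] at hb
    exact h.2 (Finsupp.mem_support_iff.2 hb)
  refine ⟨fun b => ?_, fun b hb => ?_, fun b hb c hc hbc => ?_, ?_, ?_⟩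
  · rw [Finsupp.add_apply, Finsupp.single_apply]
    split_ifs with h
    · rw [← h, hga]
    · rw [zero_add]; exact h1 b
  · rcases hsupp b hb with rfl | hb
    · exact ha
    · exact ha.trans (h2 b hb)
  · rcases hsupp b hb with rfl | hb' <;> rcases hsupp c hc with rfl | hc'
    · exact absurd rfl hbc
    · exact Or.inl (h2 c hc')
    · exact Or.inr (h2 b hb')
    · exact h3 b hb' c hc' hbc
  · rw [length_add, length_single, h4, add_comm]
  · rw [weight_add, weight_single, h5]

/-- The part of least column comes first in a chain; removing it leaves a shorter chain. -/
theorem exists_eq_single_add_of_mem_chainSet {N r e n : ℕ} {f : Freq ℓ}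
    (hf : f ∈ chainSet ℓ (N + 1) r e n) :
    ∃ a : Part ℓ, (a.1 : ℕ) ≤ n ∧ Beyond r e a ∧
      ∃ g ∈ chainSet ℓ N (row a) ((a.1 : ℕ) + 1) (n - a.1), Finsupp.single a 1 + g = f := by
  obtain ⟨h1, h2, h3, h4, h5⟩ := hf
  have hne : f.support.Nonempty := by
    rw [Finsupp.support_nonempty_iff]
    rintro rfl
    exact absurd h4 (Nat.succ_ne_zero N).symm
  obtain ⟨a, ha, hmin⟩ := f.support.exists_min_image (fun a => (a.1 : ℕ)) hne
  have hfa : f a = 1 := by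
    have := h1 a
    have := Finsupp.mem_support_iff.1 ha
    omega
  have hfg : Finsupp.single a 1 + f.erase a = f := by
    rw [← hfa]; exact Finsupp.single_add_erase a f
  have hl := congrArg length hfg
  have hw := congrArg weight hfg
  rw [length_add, length_single] at hl
  rw [weight_add, weight_single] at hw
  have hsupp : ∀ b ∈ (f.erase a).support, b ≠ a ∧ b ∈ f.support := by
    intro b hb
    rwa [Finsupp.support_erase, Finset.mem_erase] at hb
  refine ⟨a, by omega, h2 a ha, f.erase a, ⟨fun b => ?_, fun b hb => ?_, fun b hb c hc hbc => ?_,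
    by omega, by omega⟩, hfg⟩
  · have := congrArg (· b) hfg
    simp only [Finsupp.add_apply] at this
    have := h1 b
    omega
  · obtain ⟨hba, hb⟩ := hsupp b hb
    refine (h3 a ha b hb hba.symm).resolve_right fun h => ?_
    have := hmin b hb
    unfold Beyond at h
    omega
  · exact h3 b (hsupp b hb).2 c (hsupp c hc).2 hbc

/-- The first part of a chain is determined by the chain. -/
theorem eq_of_single_add_eq {N N' n n' : ℕ} {a b : Part ℓ} {g h : Freq ℓ}
    (hg : g ∈ chainSet ℓ N (row a) ((a.1 : ℕ) + 1) n)
    (hh : h ∈ chainSet ℓ N' (row b) ((b.1 : ℕ) + 1) n')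
    (heq : Finsupp.single a 1 + g = Finsupp.single b 1 + h) : a = b := by
  by_contra hab
  have e1 := congrArg (· a) heq
  have e2 := congrArg (· b) heq
  simp only [Finsupp.add_apply, Finsupp.single_apply, if_true, if_neg hab,
    if_neg (Ne.symm hab)] at e1 e2
  have h1 := hh.2.1 a (Finsupp.mem_support_iff.2 (by omega))
  have h2 := hg.2.1 b (Finsupp.mem_support_iff.2 (by omega))
  unfold Beyond at h1 h2
  omega

end Chains

/-! ### The generating function of chains -/

section Counting

variable {ℓ : ℕ}

/-- The part in row `s` whose column is the `k`-th one allowed after row `r` and column `e - 1`, if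
`e - 1` has the parity of `r`. -/
def partAt (r e : ℕ) (s : Fin (2 * ℓ)) (k : ℕ) : Part ℓ :=
  (⟨e + ((r - s) + (s - r)) + 1 + 2 * k, by omega⟩, ⟨(s : ℕ) / 2, by omega⟩)

theorem col_partAt (r e : ℕ) (s : Fin (2 * ℓ)) (k : ℕ) :
    ((partAt r e s k).1 : ℕ) = e + ((r - s) + (s - r)) + 1 + 2 * k := rfl

theorem row_partAt {r e : ℕ} (hre : (r + e) % 2 = 1) (s : Fin (2 * ℓ)) (k : ℕ) :
    row (partAt r e s k) = s := by
  simp only [row, partAt, PNat.mk_coe]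
  omega

theorem beyond_partAt {r e : ℕ} (hre : (r + e) % 2 = 1) (s : Fin (2 * ℓ)) (k : ℕ) :
    Beyond r e (partAt r e s k) := by
  rw [Beyond, row_partAt hre, col_partAt]
  omega

theorem partAt_injective {r e : ℕ} (hre : (r + e) % 2 = 1) :
    Function.Injective fun y : Fin (2 * ℓ) × ℕ => partAt r e y.1 y.2 := by
  rintro ⟨s, k⟩ ⟨s', k'⟩ h
  have hs := congrArg row h
  have hk := congrArg (fun a : Part ℓ => (a.1 : ℕ)) h
  simp only [row_partAt hre, col_partAt] at hs hk
  obtain rfl := Fin.ext hs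
  simp only [Prod.mk.injEq, true_and]
  omega

theorem Beyond.exists_eq_partAt {r e : ℕ} {a : Part ℓ} (hre : (r + e) % 2 = 1)
    (ha : Beyond r e a) : ∃ s k, k ≤ (a.1 : ℕ) ∧ partAt r e s k = a := by
  have hrow : row a % 2 = (a.1 : ℕ) % 2 := by unfold row; omega
  unfold Beyond at ha
  refine ⟨⟨row a, row_lt a⟩, ((a.1 : ℕ) - (e + ((r - row a) + (row a - r)) + 1)) / 2,
    by omega, part_ext (row_partAt hre _ _) ?_⟩
  rw [col_partAt]
  dsimp only
  omega

theorem chainSet_succ {r e : ℕ} (hre : (r + e) % 2 = 1) (N n : ℕ) :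
    chainSet ℓ (N + 1) r e n = ⋃ y ∈ {y : Fin (2 * ℓ) × ℕ |
        y ∈ Finset.univ ×ˢ Finset.range (n + 1) ∧ ((partAt r e y.1 y.2).1 : ℕ) ≤ n},
      (Finsupp.single (partAt r e y.1 y.2) 1 + ·) ''
        chainSet ℓ N y.1 (((partAt r e y.1 y.2).1 : ℕ) + 1) (n - (partAt r e y.1 y.2).1) := by
  ext f
  simp only [Set.mem_iUnion, Set.mem_image, Set.mem_ofPred_eq, exists_prop, Prod.exists,
    Finset.mem_product, Finset.mem_univ, Finset.mem_range, true_and]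
  constructor
  · intro hf
    obtain ⟨a, han, ha, g, hg, rfl⟩ := exists_eq_single_add_of_mem_chainSet hf
    obtain ⟨s, k, hk, rfl⟩ := ha.exists_eq_partAt hre
    rw [row_partAt hre] at hg
    exact ⟨s, k, ⟨by omega, han⟩, g, hg, rfl⟩
  · rintro ⟨s, k, ⟨-, han⟩, g, hg, rfl⟩
    rw [← row_partAt hre s k] at hg
    have := single_add_mem_chainSet (beyond_partAt hre s k) hg
    rwa [Nat.add_sub_cancel' han] at this

theorem coeff_q_pow_mul (a n : ℕ) (Y : MvPowerSeries (Fin 2) ℤ) :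
    MvPowerSeries.coeff (Finsupp.single 0 n) (q ^ a * Y)
      = if a ≤ n then MvPowerSeries.coeff (Finsupp.single 0 (n - a)) Y else 0 := by
  rw [q, MvPowerSeries.X_pow_eq, MvPowerSeries.coeff_monomial_mul]
  simp only [Finsupp.single_le_single, ← Finsupp.single_tsub, one_mul]

theorem invPoch_zero : invPoch 0 = 1 := by
  have := qPochhammer_mul_invPoch 0
  simpa [qPochhammer] using this

theorem invPoch_eq_mul_succ (N : ℕ) : invPoch N = (1 - q ^ (N + 1)) * invPoch (N + 1) := by
  have h0 := qPochhammer_mul_invPoch N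
  have h1 := qPochhammer_mul_invPoch (N + 1)
  rw [qPochhammer, Finset.prod_range_succ, ← qPochhammer] at h1
  linear_combination (-invPoch N) * h1 + (1 - q ^ (N + 1)) * invPoch (N + 1) * h0

/-- The geometric series `∑ₖ q ^ (2 (N + 1) k)` inverts `1 - q ^ (2 (N + 1))`; the first `n + 1`
terms suffice for the coefficient of `q ^ n`. -/
theorem coeff_geom_sum_mul (N n B : ℕ) (Y : MvPowerSeries (Fin 2) ℤ) :
    ∑ k ∈ Finset.range (n + 1), MvPowerSeries.coeff (Finsupp.single 0 n)
        (q ^ (B + (N + 1) * (2 * k)) * ((1 - q ^ (2 * (N + 1))) * Y))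
      = MvPowerSeries.coeff (Finsupp.single 0 n) (q ^ B * Y) := by
  have h : ∑ k ∈ Finset.range (n + 1),
      q ^ (B + (N + 1) * (2 * k)) * ((1 - q ^ (2 * (N + 1))) * Y)
      = q ^ B * Y - q ^ (B + 2 * (N + 1) * (n + 1)) * Y := by
    have hg := geom_sum_mul (q ^ (2 * (N + 1))) (n + 1)
    have e : ∀ k, q ^ (B + (N + 1) * (2 * k)) = q ^ B * (q ^ (2 * (N + 1))) ^ k := by
      intro k; rw [← pow_mul, ← pow_add]; congr 1; ring
    simp only [e]
    rw [← Finset.sum_mul, ← Finset.mul_sum, pow_add, pow_mul _ _ (n + 1)]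
    linear_combination (-q ^ B * Y) * hg
  rw [← map_sum, h, map_sub, coeff_q_pow_mul (B + 2 * (N + 1) * (n + 1)), if_neg (by nlinarith),
    sub_zero]

/-- The generating function of chains with `N` parts that start in row `r` and column `e - 1` is
`q ^ (N (N + e))` times the reflected Bailey-type sum. Finiteness is proved along with the count, so
that `Set.ncard` is not the junk value of an infinite set. -/
theorem ncard_chainSet (N : ℕ) {r e : ℕ} (n : ℕ) (hr : r < 2 * ℓ) (hre : (r + e) % 2 = 1) :
    (chainSet ℓ N r e n).Finite ∧ ((chainSet ℓ N r e n).ncard : ℤ)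
      = MvPowerSeries.coeff (Finsupp.single 0 n)
          (q ^ (N * (N + e)) * baileySum q invPoch ℓ (min r (2 * ℓ - 1 - r)) N) := by
  induction N generalizing r e n with
  | zero =>
    rw [chainSet_zero, baileySum_zero_right invPoch_zero, mul_one, zero_mul, pow_zero,
      MvPowerSeries.coeff_one]
    simp only [Finsupp.single_eq_zero]
    split_ifs <;> simp
  | succ N ih =>
    -- The pairs `(s, k)` that describe the possible first parts of a chain of weight `n`.
    set D : Set (Fin (2 * ℓ) × ℕ) := {y | y ∈ Finset.univ ×ˢ Finset.range (n + 1) ∧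
        ((partAt r e y.1 y.2).1 : ℕ) ≤ n} with hD
    have hDfin : D.Finite := (Finset.finite_toSet _).subset fun y hy => hy.1
    have hpar : ∀ y : Fin (2 * ℓ) × ℕ,
        ((y.1 : ℕ) + (((partAt r e y.1 y.2).1 : ℕ) + 1)) % 2 = 1 := by
      intro y; rw [col_partAt]; omega
    have hfin : ∀ y ∈ D, ((Finsupp.single (partAt r e y.1 y.2) 1 + ·) ''
        chainSet ℓ N y.1 (((partAt r e y.1 y.2).1 : ℕ) + 1) (n - (partAt r e y.1 y.2).1)).Finite :=
      fun y _ => (ih _ y.1.isLt (hpar y)).1.image _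
    have hdisj : D.PairwiseDisjoint fun y => (Finsupp.single (partAt r e y.1 y.2) 1 + ·) ''
        chainSet ℓ N y.1 (((partAt r e y.1 y.2).1 : ℕ) + 1) (n - (partAt r e y.1 y.2).1) := by
      intro y _ y' _ hne
      refine Set.disjoint_left.2 ?_
      rintro _ ⟨g, hg, rfl⟩ ⟨g', hg', heq⟩
      rw [← row_partAt hre _ y.2] at hg
      rw [← row_partAt hre _ y'.2] at hg'
      exact hne (partAt_injective hre (eq_of_single_add_eq hg hg' heq.symm))
    rw [chainSet_succ hre, ← hD]
    refine ⟨hDfin.biUnion hfin, ?_⟩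
    rw [hDfin.ncard_biUnion hfin hdisj, hD, finsum_mem_eq_finite_toFinset_sum _ hDfin]
    have hDF : hDfin.toFinset = (Finset.univ ×ˢ Finset.range (n + 1)).filter
        fun y : Fin (2 * ℓ) × ℕ => ((partAt r e y.1 y.2).1 : ℕ) ≤ n := by
      ext y; simp [hD]
    rw [hDF, Finset.sum_filter, Nat.cast_sum]
    -- First parts of column greater than `n` contribute zero on both sides.
    have hterm : ∀ y ∈ (Finset.univ : Finset (Fin (2 * ℓ))) ×ˢ Finset.range (n + 1),
        ((if ((partAt r e y.1 y.2).1 : ℕ) ≤ n then ((Finsupp.single (partAt r e y.1 y.2) 1 + ·) ''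
          chainSet ℓ N y.1 (((partAt r e y.1 y.2).1 : ℕ) + 1)
            (n - (partAt r e y.1 y.2).1)).ncard else 0 : ℕ) : ℤ)
        = MvPowerSeries.coeff (Finsupp.single 0 n)
          (q ^ ((N + 1) * (N + 1 + e) + (N + 1) * (2 * y.2)) *
            (q ^ ((N + 1) * ((r - y.1) + (y.1 - r))) *
              baileySum q invPoch ℓ (min y.1 (2 * ℓ - 1 - y.1)) N)) := by
      rintro ⟨s, k⟩ -
      dsimp only
      have hexp : q ^ ((N + 1) * (N + 1 + e) + (N + 1) * (2 * k)) *
            (q ^ ((N + 1) * ((r - s) + (s - r))) *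
              baileySum q invPoch ℓ (min s (2 * ℓ - 1 - s)) N)
          = q ^ ((partAt r e s k).1 : ℕ) * (q ^ (N * (N + (((partAt r e s k).1 : ℕ) + 1))) *
              baileySum q invPoch ℓ (min s (2 * ℓ - 1 - s)) N) := by
        rw [col_partAt]
        ring
      rw [hexp, coeff_q_pow_mul]
      split_ifs
      · rw [Set.ncard_image_of_injective _ (add_right_injective _)]
        exact (ih _ s.isLt (hpar (s, k))).2
      · rfl
    rw [Finset.sum_congr rfl hterm, Finset.sum_product_right]
    rw [← coeff_geom_sum_mul N n ((N + 1) * (N + 1 + e))]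
    refine Finset.sum_congr rfl fun k _ => ?_
    rw [← baileySum_kernel invPoch_zero invPoch_eq_mul_succ hr, ← map_sum, Finset.mul_sum,
      Finset.sum_range]

end Counting

/-! ### Admissible partitions are chains -/

section Admissibility

variable {ℓ : ℕ}

theorem max_step {a b c d : ℤ} (hac : c = a - 1 ∨ c = a + 1) (hbd : d = b - 1 ∨ d = b + 1)
    (hab : (a - b) % 2 = 0) : max c d = max a b - 1 ∨ max c d = max a b + 1 := by
  omega

theorem cone_step (c r t : ℤ) : c - |t - 1 - r| = c - |t - r| - 1 ∨
    c - |t - 1 - r| = c - |t - r| + 1 := by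
  rw [Int.abs_eq_natAbs, Int.abs_eq_natAbs]
  omega

theorem cone_parity {c r : ℤ} (h : (c - r) % 2 = 0) (t : ℤ) : (c - |t - r| - t) % 2 = 0 := by
  rw [Int.abs_eq_natAbs]
  omega

/-- Two positions whose columns differ by at most the distance of their rows lie on a common path. -/
theorem exists_isDownwardPath (r s : Fin (2 * ℓ)) {c d : ℤ} (hc : -1 ≤ c) (hd : -1 ≤ d)
    (hcr : Even (c - (r : ℕ))) (hds : Even (d - (s : ℕ)))
    (h : |c - d| ≤ |((r : ℕ) : ℤ) - ((s : ℕ) : ℤ)|) :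
    ∃ p : Fin (2 * ℓ) → ℤ, IsDownwardPath p ∧ p r = c ∧ p s = d := by
  rw [Int.even_iff] at hcr hds
  have h1 := (abs_le.1 h).1
  have h2 := (abs_le.1 h).2
  have floor : ∀ c r : ℤ, -1 ≤ c → (c - r) % 2 = 0 → -(r % 2) ≤ c := by intros; omega
  -- The leftmost zigzag line through both positions: the maximum of the cones
  -- `c - |t - r|` and `d - |t - s|` and of the left boundary of the diagram.
  refine ⟨fun t => max (-(((t : ℕ) : ℤ) % 2)) (max (c - |((t : ℕ) : ℤ) - (r : ℕ)|)
    (d - |((t : ℕ) : ℤ) - (s : ℕ)|)), ⟨fun t => ⟨?_, ?_⟩, fun t u htu => ?_⟩, ?_, ?_⟩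
  · exact le_max_of_le_left (by omega)
  · have hp1 := cone_parity hcr (t : ℕ)
    have hp2 := cone_parity hds (t : ℕ)
    rw [Int.even_iff]
    dsimp only
    generalize c - |((t : ℕ) : ℤ) - (r : ℕ)| = A at *
    generalize d - |((t : ℕ) : ℤ) - (s : ℕ)| = B at *
    omega
  · have hp1 := cone_parity hcr (t : ℕ)
    have hp2 := cone_parity hds (t : ℕ)
    have hu : ((u : ℕ) : ℤ) = (t : ℕ) - 1 := by omega
    dsimp only
    rw [hu]
    refine max_step (by omega) (max_step (cone_step _ _ _) (cone_step _ _ _) (by omega)) ?_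
    generalize c - |((t : ℕ) : ℤ) - (r : ℕ)| = A at *
    generalize d - |((t : ℕ) : ℤ) - (s : ℕ)| = B at *
    omega
  · dsimp only
    rw [sub_self, abs_zero, sub_zero, max_eq_left (a := c) (by linarith),
      max_eq_right (floor _ _ hc hcr)]
  · dsimp only
    rw [sub_self, abs_zero, sub_zero, max_eq_right (b := d) (by rw [abs_sub_comm]; linarith),
      max_eq_right (floor _ _ hd hds)]

theorem IsAdmissible.add_le {k : Fin (ℓ + 1) → ℕ} {f : Freq ℓ} (hf : IsAdmissible k f)
    {r s : Fin (2 * ℓ)} (hrs : r ≠ s) {c d : ℤ} (hc : -1 ≤ c) (hd : -1 ≤ d)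
    (hcr : Even (c - (r : ℕ))) (hds : Even (d - (s : ℕ)))
    (h : |c - d| ≤ |((r : ℕ) : ℤ) - ((s : ℕ) : ℤ)|) :
    entry k f r c + entry k f s d ≤ ∑ j, k j := by
  obtain ⟨p, hp, rfl, rfl⟩ := exists_isDownwardPath r s hc hd hcr hds h
  refine le_trans ?_ (hf p hp)
  rw [← Finset.sum_pair (f := fun r => entry k f r (p r)) hrs]
  exact Finset.sum_le_sum_of_subset (Finset.subset_univ _)

theorem IsDownwardPath.abs_sub_le {p : Fin (2 * ℓ) → ℤ} (hp : IsDownwardPath p)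
    {r s : Fin (2 * ℓ)} (hrs : r ≤ s) : |p s - p r| ≤ ((s : ℕ) : ℤ) - (r : ℕ) := by
  obtain ⟨s, hs⟩ := s
  obtain ⟨r, hr⟩ := r
  induction s, (show r ≤ s from hrs) using Nat.le_induction with
  | base => simp
  | succ s hle ih =>
    have h1 := ih (by omega) hle
    have h2 := hp.2 ⟨s + 1, hs⟩ ⟨s, by omega⟩ rfl
    rw [abs_le] at h1 ⊢
    dsimp only at *
    push_cast
    omega

theorem entry_row (k : Fin (ℓ + 1) → ℕ) (f : Freq ℓ) (a : Part ℓ) :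
    entry k f ⟨row a, row_lt a⟩ (a.1 : ℕ) = f a := by
  have hpos : (0 : ℤ) < ((a.1 : ℕ) : ℤ) := by exact_mod_cast a.1.pos
  rw [entry, dif_pos hpos]
  congr 1
  refine Prod.ext (PNat.coe_injective (by simp)) (Fin.ext ?_)
  simp only [row]
  omega

/-- The row of the only nonzero initial condition: `0` for `i = 0` (by truncated subtraction), else
`2i - 1`. -/
def startRow (i : Fin (ℓ + 1)) : ℕ := 2 * (i : ℕ) - 1

/-- One more than the column of the only nonzero initial condition: the column is `0` for `i = 0`
and `-1` otherwise. -/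
def startLevel (i : Fin (ℓ + 1)) : ℕ := if (i : ℕ) = 0 then 1 else 0

theorem startRow_lt (hℓ : 1 ≤ ℓ) (i : Fin (ℓ + 1)) : startRow i < 2 * ℓ := by
  unfold startRow; omega

theorem entry_start (hℓ : 1 ≤ ℓ) (i : Fin (ℓ + 1)) (f : Freq ℓ) :
    entry (Pi.single i 1) f ⟨startRow i, startRow_lt hℓ i⟩ ((startLevel i : ℤ) - 1) = 1 := by
  unfold startRow startLevel
  by_cases h : (i : ℕ) = 0
  · obtain rfl : i = 0 := Fin.ext h
    simp [entry]
  · rw [entry, dif_neg (by simp [h]), if_neg (by simp [h]), if_pos (by simp [h])]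
    have : (⟨(2 * (i : ℕ) - 1 + 1) / 2, by omega⟩ : Fin (ℓ + 1)) = i :=
      Fin.ext (by dsimp only; omega)
    simp [this]

/-- A nonzero entry of the diagram is the initial condition or the frequency of an occurring part. -/
theorem entry_single_cases (i : Fin (ℓ + 1)) (f : Freq ℓ) {r : Fin (2 * ℓ)} {c : ℤ}
    (hcr : Even (c - (r : ℕ))) (h : entry (Pi.single i 1) f r c ≠ 0) :
    ((r : ℕ) = startRow i ∧ c = (startLevel i : ℤ) - 1 ∧ entry (Pi.single i 1) f r c = 1) ∨
      ∃ a ∈ f.support, (r : ℕ) = row a ∧ c = (a.1 : ℕ) ∧ entry (Pi.single i 1) f r c = f a := by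
  rw [Int.even_iff] at hcr
  unfold entry at h ⊢
  split_ifs at h ⊢ with h1 h2 h3 h4
  · refine Or.inr ⟨_, Finsupp.mem_support_iff.2 h, ?_, ?_, rfl⟩
    · simp only [row, PNat.mk_coe]; omega
    · simp only [PNat.mk_coe]; omega
  · left
    have h0 : (0 : Fin (ℓ + 1)) = i := by
      by_contra hne
      exact h (Pi.single_eq_of_ne hne 1)
    subst h0
    simp [startRow, startLevel, h2, h3]
  · exact absurd rfl h
  · left
    have hi : (⟨((r : ℕ) + 1) / 2, by omega⟩ : Fin (ℓ + 1)) = i := by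
      by_contra hne
      exact h (Pi.single_eq_of_ne hne 1)
    have hi' : ((r : ℕ) + 1) / 2 = i := congrArg Fin.val hi
    refine ⟨by unfold startRow; omega, ?_, ?_⟩
    · rw [startLevel, if_neg (by omega)]; simp [h4]
    · rw [hi, Pi.single_eq_same]
  · exact absurd rfl h

theorem isAdmissible_single_iff (hℓ : 1 ≤ ℓ) (i : Fin (ℓ + 1)) (f : Freq ℓ) :
    IsAdmissible (Pi.single i 1) f ↔
      (∀ a, f a ≤ 1) ∧ (∀ a ∈ f.support, Beyond (startRow i) (startLevel i) a) ∧
      ∀ a ∈ f.support, ∀ b ∈ f.support, a ≠ b →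
        Beyond (row a) ((a.1 : ℕ) + 1) b ∨ Beyond (row b) ((b.1 : ℕ) + 1) a := by
  have hk : ∑ j, (Pi.single i 1 : Fin (ℓ + 1) → ℕ) j = 1 := by
    rw [Finset.sum_pi_single']; simp
  have hpar : ∀ a : Part ℓ, Even (((a.1 : ℕ) : ℤ) - (row a : ℕ)) := by
    intro a; rw [Int.even_iff]; unfold row; push_cast; omega
  have hpar0 : Even ((startLevel i : ℤ) - 1 - (startRow i : ℕ)) := by
    rw [Int.even_iff]; unfold startLevel startRow; split_ifs <;> omega
  have hlev : startLevel i ≤ 1 := by unfold startLevel; split_ifs <;> omega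
  constructor
  · intro hf
    refine ⟨fun a => ?_, fun a ha => ?_, fun a ha b hb hab => ?_⟩
    · obtain ⟨p, hp, hpa, -⟩ := exists_isDownwardPath ⟨row a, row_lt a⟩ ⟨row a, row_lt a⟩
        (c := (a.1 : ℕ)) (d := (a.1 : ℕ)) (by omega) (by omega) (hpar a) (hpar a) (by simp)
      rw [← entry_row (Pi.single i 1) f a, ← hpa]
      refine le_of_le_of_eq ?_ hk
      exact (Finset.single_le_sum (f := fun r => entry (Pi.single i 1) f r (p r))
        (fun _ _ => Nat.zero_le _) (Finset.mem_univ _)).trans (hf p hp)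
    · by_contra h
      have hpos := a.1.pos
      unfold Beyond at h
      have := hf.add_le (r := ⟨startRow i, startRow_lt hℓ i⟩) (s := ⟨row a, row_lt a⟩)
        (c := (startLevel i : ℤ) - 1) (d := (a.1 : ℕ)) (fun he => ?_) (by omega) (by omega)
        hpar0 (hpar a) (by rw [Int.abs_eq_natAbs, Int.abs_eq_natAbs]; dsimp only; omega)
      · rw [hk, entry_start hℓ, entry_row] at this
        have := Finsupp.mem_support_iff.1 ha
        omega
      · have := congrArg Fin.val he
        dsimp only at this
        omega
    · by_contra! h
      unfold Beyond at h
      have := hf.add_le (r := ⟨row a, row_lt a⟩) (s := ⟨row b, row_lt b⟩)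
        (c := (a.1 : ℕ)) (d := (b.1 : ℕ)) (fun he => ?_) (by omega) (by omega)
        (hpar a) (hpar b) (by rw [Int.abs_eq_natAbs, Int.abs_eq_natAbs]; dsimp only; omega)
      · rw [hk, entry_row, entry_row] at this
        have := Finsupp.mem_support_iff.1 ha
        have := Finsupp.mem_support_iff.1 hb
        omega
      · have := congrArg Fin.val he
        dsimp only at this
        exact hab (part_ext this (by omega))
  · rintro ⟨h1, h2, h3⟩ p hp
    rw [hk]
    have hle : ∀ r, entry (Pi.single i 1) f r (p r) ≤ 1 := by
      intro r
      by_cases h : entry (Pi.single i 1) f r (p r) = 0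
      · omega
      · rcases entry_single_cases i f (hp.1 r).2 h with ⟨-, -, h⟩ | ⟨a, -, -, -, h⟩
        · exact h.le
        · rw [h]; exact h1 a
    have huniq : ∀ r s, r < s → entry (Pi.single i 1) f r (p r) ≠ 0 →
        entry (Pi.single i 1) f s (p s) = 0 := by
      intro r s hrs hr
      by_contra hs
      have hlip := hp.abs_sub_le hrs.le
      have hrs' : (r : ℕ) < s := hrs
      rw [abs_le] at hlip
      rcases entry_single_cases i f (hp.1 r).2 hr with ⟨er, ec, -⟩ | ⟨a, ha, er, ec, -⟩ <;>
        rcases entry_single_cases i f (hp.1 s).2 hs with ⟨er', ec', -⟩ | ⟨b, hb, er', ec', -⟩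
      · omega
      · have := h2 b hb
        unfold Beyond at this
        omega
      · have := h2 a ha
        unfold Beyond at this
        omega
      · have hab : a ≠ b := by rintro rfl; omega
        have := h3 a ha b hb hab
        unfold Beyond at this
        omega
    by_cases hz : ∀ r, entry (Pi.single i 1) f r (p r) = 0
    · simp [hz]
    · push Not at hz
      obtain ⟨r, hr⟩ := hz
      rw [Finset.sum_eq_single r (fun s _ hsr => ?_) (by simp)]
      · exact hle r
      · rcases hsr.lt_or_gt with h | h
        · by_contra hs
          exact hr (huniq s r h hs)
        · exact huniq r s h hr

theorem admissible_single (hℓ : 1 ≤ ℓ) (i : Fin (ℓ + 1)) (j n : ℕ) :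
    admissible (Pi.single i 1) j n = chainSet ℓ j (startRow i) (startLevel i) n := by
  ext f
  simp only [admissible, chainSet, Set.mem_ofPred_eq, isAdmissible_single_iff hℓ i f, and_assoc]

end Admissibility

/-! ### Comparison of coefficients -/

/-- The index at which the linear form starts is two more than the distance of the starting row to
the nearer end of the diagram, except for `i = 0`: there the start in column `0` instead of `-1`
contributes the further summand `N_1`. -/
theorem sum_term (ℓ : ℕ) (hℓ : 1 ≤ ℓ) (i : Fin (ℓ + 1)) (N : ℕ) :
    ∑ n ∈ Finset.piAntidiag (Finset.univ : Finset (Fin ℓ)) N, term i n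
      = z ^ N * (q ^ (N * (N + startLevel i)) *
          baileySum q invPoch ℓ (min (startRow i) (2 * ℓ - 1 - startRow i)) N) := by
  have h : ∀ n ∈ Finset.piAntidiag (Finset.univ : Finset (Fin ℓ)) N,
      term i n = z ^ N * (q ^ tailExponent (linStart ℓ i) n * ∏ s, invPoch (n s)) := by
    intro n hn
    rw [term, linForm, tailSum_one, (Finset.mem_piAntidiag.1 hn).1, ← tailExponent]
    ring
  rw [Finset.sum_congr rfl h, ← Finset.mul_sum]
  congr 1
  obtain ⟨hA, hB⟩ := sum_piAntidiag_tailExponent q invPoch ℓ N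
  by_cases hi : (i : ℕ) = 0
  · have e1 : linStart ℓ i = 1 := by simp [linStart, hi]
    rw [e1, hA, startRow, startLevel, hi]
    simp only [mul_zero, Nat.zero_sub, Nat.zero_min, if_true]
    ring
  · have e1 : linStart ℓ i = min (startRow i) (2 * ℓ - 1 - startRow i) + 2 := by
      unfold linStart startRow; split_ifs <;> omega
    rw [e1, hB, startLevel, if_neg hi, add_zero, sq]

theorem coeff_z_pow_mul (N : ℕ) (d : Fin 2 →₀ ℕ) (Y : MvPowerSeries (Fin 2) ℤ) :
    MvPowerSeries.coeff d (z ^ N * Y)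
      = if N ≤ d 1 then MvPowerSeries.coeff (d - Finsupp.single 1 N) Y else 0 := by
  rw [z, MvPowerSeries.X_pow_eq, MvPowerSeries.coeff_monomial_mul, one_mul]
  simp only [Finsupp.single_le_iff]

/-- The power series in which the variable `z` does not occur. -/
def zFree : Submonoid (MvPowerSeries (Fin 2) ℤ) where
  carrier := {Y | ∀ d : Fin 2 →₀ ℕ, d 1 ≠ 0 → MvPowerSeries.coeff d Y = 0}
  one_mem' := by
    intro d hd
    rw [MvPowerSeries.coeff_one, if_neg]
    rintro rfl
    exact hd rfl
  mul_mem' := by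
    intro Y Z hY hZ d hd
    rw [MvPowerSeries.coeff_mul]
    refine Finset.sum_eq_zero fun a ha => ?_
    rw [Finset.HasAntidiagonal.mem_antidiagonal] at ha
    have h1 : a.1 1 + a.2 1 = d 1 := by rw [← ha]; rfl
    by_cases h : a.1 1 = 0
    · rw [hZ a.2 (by omega), mul_zero]
    · rw [hY a.1 h, zero_mul]

theorem q_mem_zFree : q ∈ zFree := by
  intro d hd
  rw [q, MvPowerSeries.coeff_X, if_neg]
  rintro rfl
  simp at hd

theorem invPoch_mem_zFree (N : ℕ) : invPoch N ∈ zFree := by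
  induction N with
  | zero => rw [invPoch_zero]; exact zFree.one_mem
  | succ N ih =>
    intro d hd
    induction hm : d 0 using Nat.strong_induction_on generalizing d with
    | _ m ih' =>
      have h : invPoch (N + 1) = invPoch N + q ^ (N + 1) * invPoch (N + 1) := by
        rw [invPoch_eq_mul_succ N]; ring
      rw [h, map_add, ih d hd, q, MvPowerSeries.X_pow_eq, MvPowerSeries.coeff_monomial_mul,
        zero_add, one_mul]
      split_ifs with hle
      · rw [Finsupp.single_le_iff] at hle
        refine ih' (m - (N + 1)) (by omega) _ ?_ ?_
        · simpa using hd
        · simp [hm]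
      · rfl

theorem coeff_term_eq_zero {ℓ : ℕ} (i : Fin (ℓ + 1)) {n : Fin ℓ → ℕ} {d : Fin 2 →₀ ℕ}
    (h : tailSum n 1 ≠ d 1) : MvPowerSeries.coeff d (term i n) = 0 := by
  rw [term, mul_comm (q ^ _), mul_assoc, coeff_z_pow_mul]
  split_ifs with hle
  · refine zFree.mul_mem (zFree.pow_mem q_mem_zFree _)
      (zFree.prod_mem fun s _ => invPoch_mem_zFree (n s)) _ ?_
    rw [Finsupp.tsub_apply, Finsupp.single_eq_same]
    omega
  · rfl

theorem hasSum_term (ℓ : ℕ) (hℓ : 1 ≤ ℓ) (i : Fin (ℓ + 1)) :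
    HasSum (fun n : Fin ℓ → ℕ => term i n) (genFun (Pi.single i 1)) := by
  rw [MvPowerSeries.WithPiTopology.hasSum_iff_hasSum_coeff]
  intro d
  have hd : MvPowerSeries.coeff d (genFun (Pi.single i 1 : Fin (ℓ + 1) → ℕ))
      = ∑ n ∈ Finset.piAntidiag (Finset.univ : Finset (Fin ℓ)) (d 1),
          MvPowerSeries.coeff d (term i n) := by
    have hrest : d - Finsupp.single 1 (d 1) = Finsupp.single 0 (d 0) := by
      ext t
      fin_cases t <;> simp
    rw [← map_sum, sum_term ℓ hℓ, coeff_z_pow_mul, if_pos le_rfl, hrest,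
      ← (ncard_chainSet (d 1) (d 0) (startRow_lt hℓ i) ?_).2, ← admissible_single hℓ]
    · rfl
    · unfold startRow startLevel
      split_ifs <;> omega
  rw [hd]
  refine hasSum_sum_of_ne_finset_zero fun n hn => ?_
  have hN : tailSum n 1 ≠ d 1 := by
    rw [tailSum_one]
    simpa [Finset.mem_piAntidiag] using hn
  exact coeff_term_eq_zero i hN

end CMPP

/-- The family is summed in the topology of coefficientwise convergence (`ℤ` being discrete). -/
theorem mainTheorem1 (ℓ : ℕ) (hℓ : 1 ≤ ℓ) (i : Fin (ℓ + 1)) :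
    HasSum (fun n : Fin ℓ → ℕ => CMPP.term i n)
      (CMPP.genFun (Pi.single i 1 : Fin (ℓ + 1) → ℕ)) := by
  exact CMPP.hasSum_term ℓ hℓ i
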